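/- Let $N$ be a lattice of rank $n$ with $N_{\mathbb R}=N\otimes_{\mathbb Z}\mathbb R\cong\mathbb R^n$. A fan $\Sigma$ in $N_{\mathbb R}$ is a finite nonempty collection of strongly convex rational polyhedral cones, closed under taking faces, any two of which meet in a common face; $|\Sigma|$ is the union of its cones, and $\Sigma(1)$ is its set of one-dimensional cones, where $\rho\in\Sigma(1)$ also denotes the primitive generator of the ray in $N$. The fan is simplicial if each of its cones is generated by linearly independent vectors. A refinement of $\Sigma$ is a fan with the same support, each of whose cones is contained in a cone of $\Sigma$. Let $\mathrm{PL}(\Sigma)$ be the vector space of functions $\phi:|\Sigma|\to\mathbb R$ that are given on each cone of $\Sigma$ by a linear form, and let $\mathrm{CPL}(\Sigma)$ be the set of $\phi\in\mathrm{PL}(\Sigma)$ that are convex, meaning $\phi(u)+\phi(v)\ge\phi(u+v)$ for all $u,v\in|\Sigma|$. A primitive collection for $\Sigma$ is a subset $\{\rho_1,\dots,\rho_k\}\subset\Sigma(1)$ that is not contained in a single cone of $\Sigma$ although every proper subset is. Say that primitive inequalities define $\mathrm{CPL}(\Sigma)$ if $$\mathrm{CPL}(\Sigma)=\{\phi\in\mathrm{PL}(\Sigma)\mid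 \phi(\rho_1)+\cdots+\phi(\rho_k)\ge\phi(\rho_1+\cdots+\rho_k)\text{ for all primitive collections }\{\rho_1,\dots,\rho_k\}\text{ for }\Sigma\}.$$ Casagrande's conjecture for $N$ is the assertion that primitive inequalities define $\mathrm{CPL}(\Sigma)$ for every simplicial fan $\Sigma$ in $N_{\mathbb R}$ such that $|\Sigma|$ is convex of dimension $n$. **Proposition.** Let $\Sigma$ be a non-simplicial fan in $N_{\mathbb R}$ such that $|\Sigma|$ is convex of dimension $n$ (no quasi-projectivity is assumed). 1. If Casagrande's conjecture holds for $N$, then primitive inequalities define $\mathrm{CPL}(\Sigma)$. 2. Every primitive collection $P$ for $\Sigma$ is supported on a simplicial refinement of $\Sigma$ with the same rays: there is a simplicial refinement $\Sigma'$ of $\Sigma$ with $\Sigma'(1)=\Sigma(1)$ such that $P$ is also a primitive collection for $\Sigma'$. -/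

import Mathlib

namespace Toric

/-- A fan in the real vector space `V = N_ℝ`, with respect to the lattice `L = N ⊆ V`: a finite
nonempty collection of strongly convex rational polyhedral cones that contains every face of each
of its members and in which any two cones meet in a common face. -/
structure Fan {V : Type*} [AddCommGroup V] [Module ℝ V] (L : Submodule ℤ V) where
  /-- The cones of the fan. -/
  cones : Set (PointedCone ℝ V)
  finite : cones.Finite
  nonempty : cones.Nonempty
  /-- Every cone is generated by finitely many lattice vectors. -/
  rational : ∀ σ ∈ cones, ∃ S : Finset V, (S : Set V) ⊆ L ∧ PointedCone.hull ℝ (S : Set V) = σ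
  /-- Every cone is strongly convex: it contains no line. -/
  stronglyConvex : ∀ σ ∈ cones, σ.lineal = ⊥
  face_mem : ∀ σ ∈ cones, ∀ τ : PointedCone ℝ V, τ.IsFaceOf σ → τ ∈ cones
  inter_isFaceOf : ∀ σ ∈ cones, ∀ τ ∈ cones, (σ ⊓ τ).IsFaceOf σ

/-- A primitive lattice vector: a nonzero element of `L` that is not a proper positive integer
multiple of an element of `L`. -/
def IsPrimitiveVector {V : Type*} [AddCommGroup V] (L : Submodule ℤ V) (u : V) : Prop :=
  u ∈ L ∧ u ≠ 0 ∧ ∀ (k : ℕ), ∀ w ∈ L, u = k • w → k = 1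

namespace Fan

variable {V : Type*} [AddCommGroup V] [Module ℝ V] {L : Submodule ℤ V}

/-- The support of a fan: the union of its cones. -/
def support (F : Fan L) : Set V := ⋃ σ ∈ F.cones, (σ : Set V)

/-- The support is convex, and its dimension is that of the ambient space `V`. -/
def HasConvexFullDimSupport (F : Fan L) : Prop :=
  Convex ℝ F.support ∧ affineSpan ℝ F.support = ⊤

/-- A fan is simplicial if each of its cones is generated by linearly independent vectors. -/
def IsSimplicial (F : Fan L) : Prop := ∀ σ ∈ F.cones, σ.IsSimplicial

/-- The one-dimensional cones of the fan, each identified with its primitive generator: the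
primitive lattice vectors `u` for which the ray spanned by `u` is a cone of the fan. -/
def rayGens (F : Fan L) : Set V :=
  {u | IsPrimitiveVector L u ∧ PointedCone.hull ℝ {u} ∈ F.cones}

/-- `F'` is a refinement of `F`: it has the same support, and each of its cones is contained in a
cone of `F`. -/
def Refines (F' F : Fan L) : Prop :=
  F'.support = F.support ∧ ∀ σ' ∈ F'.cones, ∃ σ ∈ F.cones, σ' ≤ σ

/-- The vector space of piecewise linear functions on the fan: the functions on the support that
are given on each cone by a linear form on `V`. A function on the support is represented by its
extension by zero to `V`. -/
def PL (F : Fan L) : Submodule ℝ (V → ℝ) where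
  carrier := {φ | (∀ σ ∈ F.cones, ∃ m : Module.Dual ℝ V, ∀ u ∈ σ, φ u = m u) ∧
    ∀ u, u ∉ F.support → φ u = 0}
  zero_mem' := ⟨fun _ _ => ⟨0, fun _ _ => rfl⟩, fun _ _ => rfl⟩
  add_mem' := by
    rintro φ ψ ⟨h₁, h₂⟩ ⟨h₃, h₄⟩
    refine ⟨fun σ hσ => ?_, fun u hu => by simp [h₂ u hu, h₄ u hu]⟩
    obtain ⟨m, hm⟩ := h₁ σ hσ
    obtain ⟨m', hm'⟩ := h₃ σ hσ
    exact ⟨m + m', fun u hu => by simp [hm u hu, hm' u hu]⟩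
  smul_mem' := by
    rintro c φ ⟨h₁, h₂⟩
    refine ⟨fun σ hσ => ?_, fun u hu => by simp [h₂ u hu]⟩
    obtain ⟨m, hm⟩ := h₁ σ hσ
    exact ⟨c • m, fun u hu => by simp [hm u hu]⟩

/-- The cone of convex piecewise linear functions on the fan. -/
def CPL (F : Fan L) : Set (V → ℝ) :=
  {φ | φ ∈ F.PL ∧ ∀ u ∈ F.support, ∀ v ∈ F.support, φ (u + v) ≤ φ u + φ v}

/-- A primitive collection: a set of ray generators that is not contained in a single cone of the
fan, while each of its proper subsets is. -/
def IsPrimitiveCollection (F : Fan L) (P : Finset V) : Prop :=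
  (P : Set V) ⊆ F.rayGens ∧ (¬ ∃ σ ∈ F.cones, (P : Set V) ⊆ σ) ∧
    ∀ Q : Finset V, Q ⊂ P → ∃ σ ∈ F.cones, (Q : Set V) ⊆ σ

/-- The primitive inequality for `P`. -/
def SatisfiesPrimitiveInequality (φ : V → ℝ) (P : Finset V) : Prop :=
  φ (∑ u ∈ P, u) ≤ ∑ u ∈ P, φ u

/-- `CPL(F)` is the set of piecewise linear functions that satisfy the primitive inequality for
every primitive collection of the fan. -/
def CPLDefinedByPrimitiveInequalities (F : Fan L) : Prop :=
  F.CPL = {φ | φ ∈ F.PL ∧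
    ∀ P : Finset V, F.IsPrimitiveCollection P → SatisfiesPrimitiveInequality φ P}

/-- The primitive collection `P` of `F` is supported on `F'`: here `F'` is a simplicial refinement
of `F` with the same rays, and `P` is a primitive collection for `F'` as well. -/
def IsSupportedOn (F : Fan L) (P : Finset V) (F' : Fan L) : Prop :=
  F'.IsSimplicial ∧ F'.Refines F ∧ F'.rayGens = F.rayGens ∧
    F.IsPrimitiveCollection P ∧ F'.IsPrimitiveCollection P

end Fan

/-- Casagrande's conjecture for fans with respect to the lattice `L`: primitive inequalities define
`CPL` for every simplicial fan whose support is convex and of full dimension. -/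
def CasagrandeConjecture {V : Type*} [AddCommGroup V] [Module ℝ V] (L : Submodule ℤ V) : Prop :=
  ∀ F : Fan L, F.IsSimplicial → F.HasConvexFullDimSupport → F.CPLDefinedByPrimitiveInequalities

end Toric

/-! Both assertions rest on one construction: the pulling refinement of a fan Σ for a total order
`f` of its rays. A set of ray generators is pulled (`IsPulled`) if each of its elements is the
earliest ray of some cone of Σ that contains it and all later elements. The hulls of pulled sets
form a simplicial refinement with the same rays. Nonnegative combinations of pulled sets are
determined by their sum (`IsPulled.linearCombination_injective`), which gives both linear
independence and intersection in common faces. The hulls cover the support because subtracting from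
a point of a cone the largest possible multiple of the earliest ray leads to a face without that
ray, where induction applies (`exists_isPulled_mem_hull`).

For a primitive collection P, choose an order in which P comes first. Then every proper subset of P
is pulled (`IsPrimitiveCollection.isPulled`), while P itself lies in no cone of the refinement,
since it lies in none of Σ.

For the inequalities, let Σ' be a refinement with the same rays. Then PL(Σ) ⊆ PL(Σ'), and a
primitive collection of Σ' either lies in a cone of Σ, where the functions in PL(Σ) are linear, or
is primitive for Σ. So the inequalities for Σ imply those for Σ', and the simplicial case yields
convexity. -/

namespace PointedCone

/-! ### Faces and extremal generators of strongly convex cones. -/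

variable {V : Type*} [AddCommGroup V] [Module ℝ V]

theorem mem_hull_singleton {x y : V} : x ∈ hull ℝ {y} ↔ ∃ c : ℝ, 0 ≤ c ∧ x = c • y := by
  rw [hull, Submodule.mem_span_singleton]
  constructor
  · rintro ⟨⟨a, ha⟩, rfl⟩
    exact ⟨a, ha, rfl⟩
  · rintro ⟨a, ha, rfl⟩
    exact ⟨⟨a, ha⟩, rfl⟩

theorem hull_singleton_smul {c : ℝ} (hc : 0 < c) (x : V) : hull ℝ {c • x} = hull ℝ {x} := by
  apply le_antisymm
  · refine Submodule.span_le.2 (Set.singleton_subset_iff.2 ?_)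
    exact mem_hull_singleton.2 ⟨c, hc.le, rfl⟩
  · refine Submodule.span_le.2 (Set.singleton_subset_iff.2 ?_)
    exact mem_hull_singleton.2 ⟨c⁻¹, by positivity, by rw [smul_smul, inv_mul_cancel₀ hc.ne', one_smul]⟩

theorem mem_hull_iff_linearCombination {s : Set V} {x : V} :
    x ∈ hull ℝ s ↔ ∃ c : V →₀ ℝ, (c.support : Set V) ⊆ s ∧ 0 ≤ c ∧
      Finsupp.linearCombination ℝ id c = x := by
  rw [mem_hull_set]
  rfl

theorem linearCombination_mem {σ : PointedCone ℝ V} {c : V →₀ ℝ} (hc : 0 ≤ c)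
    (hσ : (c.support : Set V) ⊆ σ) : Finsupp.linearCombination ℝ id c ∈ σ :=
  Submodule.span_le.2 hσ (mem_hull_iff_linearCombination.2 ⟨c, subset_rfl, hc, rfl⟩)

theorem eq_zero_of_add_eq_zero {σ : PointedCone ℝ V} (hσ : σ.lineal = ⊥) {x y : V} (hx : x ∈ σ)
    (hy : y ∈ σ) (h : x + y = 0) : x = 0 := by
  have : x ∈ σ.lineal := PointedCone.mem_lineal.2 ⟨hx, by rwa [neg_eq_of_add_eq_zero_right h]⟩
  simpa [hσ] using this

theorem lineal_eq_bot_of_le {σ τ : PointedCone ℝ V} (hτ : τ.lineal = ⊥) (h : σ ≤ τ) :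
    σ.lineal = ⊥ :=
  (Submodule.eq_bot_iff _).2 fun _ hx =>
    eq_zero_of_add_eq_zero hτ (h hx.1) (h hx.2) (add_neg_cancel _)

theorem bot_isFaceOf {σ : PointedCone ℝ V} (hσ : σ.lineal = ⊥) :
    (⊥ : PointedCone ℝ V).IsFaceOf σ := by
  have h := IsFaceOf.lineal σ
  rw [hσ] at h
  exact h

/-- The support of a nonnegative combination lies in every face that contains the sum. -/
theorem IsFaceOf.support_subset {σ τ : PointedCone ℝ V} (h : τ.IsFaceOf σ) {c : V →₀ ℝ}
    (hc : 0 ≤ c) (hσ : (c.support : Set V) ⊆ σ) (hτ : Finsupp.linearCombination ℝ id c ∈ τ) :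
    (c.support : Set V) ⊆ τ := by
  classical
  intro v hv
  have hv' : 0 < c v := lt_of_le_of_ne (hc v) (Finsupp.mem_support_iff.1 hv).symm
  rw [← Finsupp.single_add_erase v c, map_add, Finsupp.linearCombination_single] at hτ
  refine h.mem_of_smul_add_mem (hσ hv) (linearCombination_mem ?_ ?_) hv' hτ
  · intro w
    by_cases hw : w = v
    · simp [hw]
    · simpa [Finsupp.erase_ne hw] using hc w
  · exact fun w hw => hσ (by simp_all)

/-- The smallest face of a cone that contains a given point. -/
def faceAt (σ : PointedCone ℝ V) (y : V) (hy : y ∈ σ) : PointedCone ℝ V where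
  carrier := {z | z ∈ σ ∧ ∃ ε : ℝ, 0 < ε ∧ y - ε • z ∈ σ}
  zero_mem' := ⟨σ.zero_mem, 1, one_pos, by simpa using hy⟩
  add_mem' := by
    rintro a b ⟨ha, ε, hε, ha'⟩ ⟨hb, δ, hδ, hb'⟩
    -- The convex weights δ/(ε+δ) and ε/(ε+δ) give `a` and `b` this same coefficient.
    refine ⟨add_mem ha hb, ε * δ / (ε + δ), by positivity, ?_⟩
    have e : y - (ε * δ / (ε + δ)) • (a + b) =
        (δ / (ε + δ)) • (y - ε • a) + (ε / (ε + δ)) • (y - δ • b) := by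
      have : y = (δ / (ε + δ)) • y + (ε / (ε + δ)) • y := by
        rw [← add_smul, ← add_div, add_comm δ, div_self (by positivity), one_smul]
      nth_rewrite 1 [this]
      match_scalars <;> field_simp
    rw [e]
    exact add_mem (σ.smul_mem (by positivity) ha') (σ.smul_mem (by positivity) hb')
  smul_mem' := by
    rintro ⟨c, hc⟩ z ⟨hz, ε, hε, hz'⟩
    -- Dividing by `c + 1` rather than `c` covers `c = 0`.
    refine ⟨σ.smul_mem hc hz, ε / (c + 1), by positivity, ?_⟩
    have e : y - (ε / (c + 1)) • (c • z) = (1 / (c + 1)) • y + (c / (c + 1)) • (y - ε • z) := by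
      match_scalars <;> field_simp
      ring
    change y - (ε / (c + 1)) • (c • z) ∈ σ
    rw [e]
    exact add_mem (σ.smul_mem (by positivity) hy) (σ.smul_mem (by positivity) hz')

theorem self_mem_faceAt {σ : PointedCone ℝ V} {y : V} (hy : y ∈ σ) : y ∈ σ.faceAt y hy :=
  ⟨hy, 1, one_pos, by simp⟩

theorem faceAt_isFaceOf {σ : PointedCone ℝ V} {y : V} (hy : y ∈ σ) :
    (σ.faceAt y hy).IsFaceOf σ := by
  refine IsFaceOf.of_mem_of_add_mem_left (fun z hz => hz.1) ?_
  rintro a b ha hb ⟨-, ε, hε, h⟩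
  refine ⟨ha, ε, hε, ?_⟩
  have e : y - ε • a = (y - ε • (a + b)) + ε • b := by module
  rw [e]
  exact add_mem h (σ.smul_mem hε.le hb)

/-- A strongly convex cone with finitely many generators is generated by those of them that span
one-dimensional faces. -/
theorem exists_subset_generators_isFaceOf (S : Finset V) (hS : (hull ℝ (S : Set V)).lineal = ⊥) :
    ∃ T ⊆ S, hull ℝ (T : Set V) = hull ℝ (S : Set V) ∧
      ∀ t ∈ T, t ≠ 0 ∧ (hull ℝ {t}).IsFaceOf (hull ℝ (S : Set V)) := by
  classical
  -- An inclusion-minimal generating subset: no element lies in the hull of the others.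
  obtain ⟨T, hT⟩ := (S.powerset.filter
    fun T : Finset V => hull ℝ (T : Set V) = hull ℝ (S : Set V)).exists_minimal ⟨S, by simp⟩
  have hmem := hT.prop
  rw [Finset.mem_filter, Finset.mem_powerset] at hmem
  obtain ⟨hTS, hTe⟩ := hmem
  have key : ∀ t ∈ T, t ∉ hull ℝ ((T.erase t : Finset V) : Set V) := by
    intro t ht hmem
    have hle : T.erase t ∈ S.powerset.filter
        fun T : Finset V => hull ℝ (T : Set V) = hull ℝ (S : Set V) := by
      rw [Finset.mem_filter, Finset.mem_powerset]
      refine ⟨(Finset.erase_subset _ _).trans hTS, ?_⟩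
      rw [← hTe]
      apply le_antisymm
      · exact Submodule.span_mono (by exact_mod_cast Finset.erase_subset _ _)
      · refine Submodule.span_le.2 fun s hs => ?_
        by_cases h : s = t
        · exact h ▸ hmem
        · exact subset_hull (by simpa [h] using hs)
    have := hT.le_of_le hle (Finset.erase_subset _ _) ht
    simp at this
  refine ⟨T, hTS, hTe, fun t ht => ⟨fun h => key t ht (h ▸ zero_mem _), ?_⟩⟩
  rw [← hTe] at hS ⊢
  have hsplit : ∀ x ∈ hull ℝ (T : Set V), ∃ a : ℝ, 0 ≤ a ∧
      ∃ x' ∈ hull ℝ ((T.erase t : Finset V) : Set V), x = a • t + x' := by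
    intro x hx
    rw [← Finset.insert_erase ht, Finset.coe_insert, hull, Submodule.mem_span_insert] at hx
    obtain ⟨⟨a, ha⟩, z, hz, rfl⟩ := hx
    exact ⟨a, ha, z, hz, rfl⟩
  have hle : hull ℝ ((T.erase t : Finset V) : Set V) ≤ hull ℝ (T : Set V) :=
    Submodule.span_mono (by exact_mod_cast Finset.erase_subset _ _)
  have htT : t ∈ hull ℝ (T : Set V) := subset_hull ht
  refine IsFaceOf.of_mem_of_add_mem_left ?_ ?_
  · exact Submodule.span_le.2 (Set.singleton_subset_iff.2 htT)
  · intro x y hx hy hxy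
    obtain ⟨a, ha, x', hx', rfl⟩ := hsplit x hx
    obtain ⟨b, hb, y', hy', rfl⟩ := hsplit y hy
    obtain ⟨c, hc, hxy⟩ := mem_hull_singleton.1 hxy
    have e : x' + y' = (c - (a + b)) • t := by
      rw [sub_smul, ← hxy]
      module
    -- Otherwise `t` is a positive multiple of `x' + y'`, hence redundant. Once this is known, `x'`
    -- and its negative both lie in the cone, so `x' = 0`.
    have hab : c ≤ a + b := by
      by_contra! h
      refine key t ht ?_
      have h' := smul_mem _ (inv_nonneg.2 (sub_pos.2 h).le) (add_mem hx' hy')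
      rwa [e, smul_smul, inv_mul_cancel₀ (sub_pos.2 h).ne', one_smul] at h'
    have hx0 : x' = 0 := by
      refine eq_zero_of_add_eq_zero (y := y' + (a + b - c) • t) hS (hle hx')
        (add_mem (hle hy') (smul_mem _ (sub_nonneg.2 hab) htT)) ?_
      rw [← add_assoc, e]
      module
    exact mem_hull_singleton.2 ⟨a, ha, by rw [hx0, add_zero]⟩

end PointedCone

/-! ### Positive forms and compactness for finitely generated cones. -/

namespace PointedCone

variable {V : Type*} [NormedAddCommGroup V] [NormedSpace ℝ V]

/-- A linear form that is positive on finitely many given nonzero vectors of a strongly convex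
cone. -/
theorem exists_pos_on_generators (R : Finset V) (h0 : (0 : V) ∉ R)
    (hR : (hull ℝ (R : Set V)).lineal = ⊥) :
    ∃ f : StrongDual ℝ V, ∀ r ∈ R, 0 < f r := by
  -- A vanishing convex combination would put a nonzero multiple of a generator in the lineality
  -- space; hence 0 can be strictly separated from the compact hull.
  have hzero : (0 : V) ∉ convexHull ℝ (R : Set V) := by
    intro h
    rw [Finset.mem_convexHull] at h
    obtain ⟨w, hw, hw1, hw0⟩ := h
    rw [Finset.centerMass_eq_of_sum_1 _ _ hw1] at hw0
    obtain ⟨r, hr, hr0⟩ : ∃ r ∈ R, w r ≠ 0 := by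
      by_contra! h
      simp [Finset.sum_eq_zero h] at hw1
    classical
    rw [← Finset.add_sum_erase _ _ hr] at hw0
    have := eq_zero_of_add_eq_zero hR (smul_mem _ (hw r hr) (subset_hull hr))
      (sum_mem fun s hs => smul_mem _ (hw s (Finset.mem_of_mem_erase hs))
        (subset_hull (Finset.mem_of_mem_erase hs))) hw0
    rw [smul_eq_zero] at this
    exact this.elim hr0 fun h => h0 (h ▸ hr)
  obtain ⟨f, u, hu, hf⟩ := geometric_hahn_banach_point_closed (convex_convexHull ℝ _)
    (R.finite_toSet.isCompact_convexHull ℝ).isClosed hzero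
  rw [map_zero] at hu
  exact ⟨f, fun r hr => hu.trans (hf r (subset_convexHull ℝ _ hr))⟩

/-- From a point of a strongly convex finitely generated cone one can subtract a largest possible
multiple of a generator. -/
theorem exists_eq_smul_add_maximal (R : Finset V) (h0 : (0 : V) ∉ R)
    (hR : (hull ℝ (R : Set V)).lineal = ⊥) {v x : V} (hv : v ∈ R) (hx : x ∈ hull ℝ (R : Set V)) :
    ∃ t : ℝ, 0 ≤ t ∧ ∃ y ∈ hull ℝ (R : Set V), x = t • v + y ∧
      ∀ ε : ℝ, 0 < ε → y - ε • v ∉ hull ℝ (R : Set V) := by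
  classical
  obtain ⟨f, hf⟩ := exists_pos_on_generators R h0 hR
  have hrepr : ∀ z ∈ hull ℝ (R : Set V), ∃ c : R → ℝ, (∀ r, 0 ≤ c r) ∧ ∑ r, c r • (r : V) = z := by
    intro z hz
    obtain ⟨c, hcR, hc, rfl⟩ := mem_hull_iff_linearCombination.1 hz
    refine ⟨fun r => c r, fun r => hc r, ?_⟩
    rw [Finsupp.linearCombination_apply, Finsupp.sum_of_support_subset c (by exact_mod_cast hcR) _
      (by simp)]
    exact Finset.sum_coe_sort R fun r => c r • r
  let K : Set (R → ℝ) := {c | (∀ r, 0 ≤ c r) ∧ ∑ r, c r • (r : V) = x}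
  have hK : IsCompact K := by
    -- Applying `f` to a representation of `x` bounds every coefficient by `f x / f r`.
    refine (isCompact_Icc (a := (0 : R → ℝ)) (b := fun r => f x / f r)).of_isClosed_subset ?_ ?_
    · have h1 : IsClosed {c : R → ℝ | ∀ r, 0 ≤ c r} := by
        simp only [Set.ofPred_forall]
        exact isClosed_iInter fun r => isClosed_le continuous_const (continuous_apply r)
      exact h1.inter (isClosed_eq (by fun_prop) continuous_const)
    · rintro c ⟨hc, hcx⟩
      refine ⟨hc, fun r => ?_⟩
      rw [le_div_iff₀ (hf r r.2), ← hcx, map_sum]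
      simp only [map_smul, smul_eq_mul]
      exact Finset.single_le_sum (f := fun r : R => c r * f r)
        (fun s _ => mul_nonneg (hc s) (hf s s.2).le) (Finset.mem_univ r)
  obtain ⟨c, ⟨hc, hcx⟩, hmax⟩ := hK.exists_isMaxOn (hrepr x hx)
    (f := fun c => c ⟨v, hv⟩) (continuous_apply _).continuousOn
  refine ⟨c ⟨v, hv⟩, hc _, ∑ r ∈ Finset.univ.erase ⟨v, hv⟩, c r • (r : V),
    sum_mem fun r _ => smul_mem _ (hc r) (subset_hull r.2), ?_, ?_⟩
  · rw [← hcx, Finset.add_sum_erase _ (fun r : R => c r • (r : V)) (Finset.mem_univ ⟨v, hv⟩)]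
  · intro ε hε hmem
    obtain ⟨d, hd, hdy⟩ := hrepr _ hmem
    -- This representation of `x` would have a larger coefficient at `v` than the maximal one.
    have hin : d + Pi.single ⟨v, hv⟩ (c ⟨v, hv⟩ + ε) ∈ K := by
      refine ⟨fun r => add_nonneg (hd r) ?_, ?_⟩
      · by_cases h : r = ⟨v, hv⟩
        · subst h
          simpa using add_nonneg (hc _) hε.le
        · simp [h]
      · have hsingle : ∑ r : R, (Pi.single ⟨v, hv⟩ (c ⟨v, hv⟩ + ε) : R → ℝ) r • (r : V) =
            (c ⟨v, hv⟩ + ε) • v := by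
          rw [Finset.sum_eq_single ⟨v, hv⟩ (by intro b _ hb; simp [hb]) (by simp)]
          simp
        simp only [Pi.add_apply, add_smul, Finset.sum_add_distrib, hdy] at hsingle ⊢
        rw [hsingle, ← hcx,
          ← Finset.add_sum_erase _ (fun r : R => c r • (r : V)) (Finset.mem_univ ⟨v, hv⟩)]
        module
    have h1 := hmax hin
    have h2 := hd ⟨v, hv⟩
    simp at h1
    linarith

end PointedCone

/-! ### Intersections and least cones in a fan. -/

namespace Toric.Fan

variable {V : Type*} [AddCommGroup V] [Module ℝ V] {L : Submodule ℤ V} {F : Fan L}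

theorem inf_mem {σ τ : PointedCone ℝ V} (hσ : σ ∈ F.cones) (hτ : τ ∈ F.cones) :
    σ ⊓ τ ∈ F.cones :=
  F.face_mem σ hσ _ (F.inter_isFaceOf σ hσ τ hτ)

theorem bot_mem : (⊥ : PointedCone ℝ V) ∈ F.cones := by
  obtain ⟨σ, hσ⟩ := F.nonempty
  exact F.face_mem σ hσ _ (PointedCone.bot_isFaceOf (F.stronglyConvex σ hσ))

/-- The cones containing `S` are finite in number and closed under intersection, so a minimal one is
least. -/
theorem exists_least_cone {S : Set V} (h : ∃ σ ∈ F.cones, S ⊆ σ) :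
    ∃ σ ∈ F.cones, S ⊆ σ ∧ ∀ τ ∈ F.cones, S ⊆ τ → σ ≤ τ := by
  obtain ⟨σ, ⟨hσ, hS⟩, hmin⟩ := (F.finite.subset
    (Set.sep_subset F.cones fun σ => S ⊆ σ)).exists_minimal h
  exact ⟨σ, hσ, hS, fun τ hτ hSτ =>
    (hmin ⟨inf_mem hσ hτ, Set.subset_inter hS hSτ⟩ inf_le_left).trans inf_le_right⟩

end Toric.Fan

/-! ### Primitive lattice vectors and ray generators. -/

namespace Toric

variable {V : Type*} [NormedAddCommGroup V] [NormedSpace ℝ V] {L : Submodule ℤ V}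

/-- The real multiples of a nonzero lattice vector that lie in the lattice are the integer multiples
of one of them. -/
theorem exists_generator_smul_mem [DiscreteTopology L] {s : V} (hs : s ∈ L) (h0 : s ≠ 0) :
    ∃ g : ℝ, 0 < g ∧ ∀ c : ℝ, c • s ∈ L ↔ ∃ m : ℤ, m * g = c := by
  obtain ⟨ε, hε, h⟩ := Metric.exists_ball_inter_eq_singleton_of_mem_discrete (s := (L : Set V))
    (isDiscrete_iff_discreteTopology.2 ‹_›) L.zero_mem
  let H : AddSubgroup ℝ := L.toAddSubgroup.comap ((LinearMap.toSpanSingleton ℝ V s).toAddMonoidHom)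
  have hH : ∀ c, c ∈ H ↔ c • s ∈ L := fun c => Iff.rfl
  have hs' : 0 < ‖s‖ := norm_pos_iff.2 h0
  obtain ⟨g, hg⟩ := AddSubgroup.cyclic_of_isolated_zero (H := H) (a := ε / ‖s‖) (by positivity) (by
    rw [Set.disjoint_left]
    rintro c hc ⟨hc0, hc1⟩
    have : c • s ∈ ({0} : Set V) := by
      rw [← h]
      refine ⟨?_, hc⟩
      rw [mem_ball_zero_iff, norm_smul, Real.norm_of_nonneg hc0.le]
      exact (lt_div_iff₀ hs').1 hc1
    simp [h0, hc0.ne'] at this)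
  have hmem : ∀ c : ℝ, c • s ∈ L ↔ ∃ m : ℤ, m * g = c := by
    intro c
    rw [← hH, hg, AddSubgroup.mem_closure_singleton]
    simp
  have hg0 : g ≠ 0 := by
    rintro rfl
    obtain ⟨m, hm⟩ := (hmem 1).1 (by simpa using hs)
    simp at hm
  refine ⟨|g|, abs_pos.2 hg0, fun c => (hmem c).trans ?_⟩
  rcases abs_choice g with h | h
  · rw [h]
  · rw [h]
    constructor
    · rintro ⟨m, rfl⟩
      exact ⟨-m, by simp⟩
    · rintro ⟨m, rfl⟩
      exact ⟨-m, by simp⟩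

theorem IsPrimitiveVector.smul_mem_iff [DiscreteTopology L] {u : V} (hu : IsPrimitiveVector L u)
    {c : ℝ} : c • u ∈ L ↔ ∃ m : ℤ, (m : ℝ) = c := by
  obtain ⟨huL, hu0, hprim⟩ := hu
  obtain ⟨g, hg, h⟩ := exists_generator_smul_mem huL hu0
  obtain ⟨k, hk⟩ := (h 1).1 (by simpa using huL)
  have hk0 : 0 < k := by
    have : (0 : ℝ) < k := pos_of_mul_pos_left (hk ▸ one_pos) hg.le
    exact_mod_cast this
  lift k to ℕ using hk0.le
  rw [Int.cast_natCast] at hk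
  have := hprim k (g • u) ((h g).2 ⟨1, by simp⟩) (by
    rw [← Nat.cast_smul_eq_nsmul ℝ, smul_smul, hk, one_smul])
  subst this
  have hg1 : g = 1 := by simpa using hk
  simpa [hg1] using h c

theorem IsPrimitiveVector.eq_of_mem_hull [DiscreteTopology L] {u w : V}
    (hu : IsPrimitiveVector L u) (hw : IsPrimitiveVector L w)
    (h : w ∈ PointedCone.hull ℝ {u}) : w = u := by
  obtain ⟨c, hc, rfl⟩ := PointedCone.mem_hull_singleton.1 h
  obtain ⟨m, rfl⟩ := hu.smul_mem_iff.1 hw.1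
  lift m to ℕ using (by exact_mod_cast hc)
  rw [Int.cast_natCast, Nat.cast_smul_eq_nsmul ℝ] at hw ⊢
  rw [hw.2.2 m u hu.1 rfl, one_smul]

theorem exists_isPrimitiveVector [DiscreteTopology L] {s : V} (hs : s ∈ L) (h0 : s ≠ 0) :
    ∃ u, IsPrimitiveVector L u ∧ ∃ c : ℝ, 0 < c ∧ s = c • u := by
  obtain ⟨g, hg, h⟩ := exists_generator_smul_mem hs h0
  refine ⟨g • s, ⟨(h g).2 ⟨1, by simp⟩, by simp [hg.ne', h0], fun k w hw hk => ?_⟩, g⁻¹,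
    by positivity, by rw [smul_smul, inv_mul_cancel₀ hg.ne', one_smul]⟩
  have hk0 : (k : ℝ) ≠ 0 := by
    intro hk0
    rw [Nat.cast_eq_zero] at hk0
    simp [hk0, hg.ne', h0] at hk
  have hw' : w = (g / k) • s := by
    rw [← Nat.cast_smul_eq_nsmul ℝ] at hk
    rw [div_eq_inv_mul, ← smul_smul, hk, smul_smul, inv_mul_cancel₀ hk0, one_smul]
  rw [hw'] at hw
  obtain ⟨m, hm⟩ := (h _).1 hw
  have hmk : ((k : ℤ) * m : ℤ) = 1 := by
    have : (k : ℝ) * m = 1 := by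
      field_simp at hm
      linarith
    exact_mod_cast this
  have := Int.eq_one_or_neg_one_of_mul_eq_one hmk
  omega

namespace Fan

variable {F : Fan L}

variable [DiscreteTopology L]

variable (F) in
theorem rayGens_finite : F.rayGens.Finite := by
  refine Set.Finite.of_finite_image (f := fun u => PointedCone.hull ℝ {u})
    (F.finite.subset ?_) ?_
  · rintro _ ⟨u, hu, rfl⟩
    exact hu.2
  · intro u hu w hw h
    refine hw.1.eq_of_mem_hull hu.1 ?_
    change PointedCone.hull ℝ {u} = PointedCone.hull ℝ {w} at h
    rw [← h]
    exact PointedCone.subset_hull rfl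

/-- Rational generators can be thinned to those spanning extremal rays, and each of these is a
positive multiple of a primitive vector. -/
theorem hull_rayGens_inter {σ : PointedCone ℝ V} (hσ : σ ∈ F.cones) :
    PointedCone.hull ℝ (F.rayGens ∩ σ) = σ := by
  refine le_antisymm (Submodule.span_le.2 Set.inter_subset_right) ?_
  obtain ⟨S, hSL, rfl⟩ := F.rational σ hσ
  obtain ⟨T, hTS, hT, hface⟩ :=
    PointedCone.exists_subset_generators_isFaceOf S (F.stronglyConvex _ hσ)
  conv_lhs => rw [← hT]
  refine Submodule.span_le.2 fun t ht => ?_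
  obtain ⟨u, hu, c, hc, rfl⟩ := exists_isPrimitiveVector (hSL (hTS ht)) (hface t ht).1
  have hray := F.face_mem _ hσ _ (hface _ ht).2
  have hle := (hface _ ht).2.le
  rw [PointedCone.hull_singleton_smul hc] at hray hle
  exact PointedCone.smul_mem _ hc.le
    (PointedCone.subset_hull ⟨⟨hu, hray⟩, hle (PointedCone.subset_hull rfl)⟩)

end Fan

end Toric
-- Pulled sets: uniqueness of nonnegative combinations.
namespace Toric

namespace Fan

variable {V : Type*} [AddCommGroup V] [Module ℝ V] {L : Submodule ℤ V} {F : Fan L} {f : V → ℕ}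

variable (F f) in
/-- The sets of ray generators that span the cones of the pulling refinement for the order `f`:
each element is the least ray generator of a cone that contains all later elements. -/
def IsPulled (S : Set V) : Prop :=
  S ⊆ F.rayGens ∧ ∀ s ∈ S, ∃ σ ∈ F.cones,
    {t ∈ S | f s ≤ f t} ⊆ σ ∧ ∀ r ∈ F.rayGens, r ∈ σ → f s ≤ f r

theorem IsPulled.mono {S T : Set V} (hS : F.IsPulled f S) (h : T ⊆ S) : F.IsPulled f T := by
  refine ⟨h.trans hS.1, fun t ht => ?_⟩
  obtain ⟨σ, hσ, hSσ, hmin⟩ := hS.2 t (h ht)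
  exact ⟨σ, hσ, fun u hu => hSσ ⟨h hu.1, hu.2⟩, hmin⟩

theorem ne_zero_of_mem_rayGens {u : V} (hu : u ∈ F.rayGens) : u ≠ 0 := hu.1.2.1

/-- The cone attached to the earliest element of `S` works; for empty `S`, the zero cone does. -/
theorem IsPulled.exists_cone {S : Set V} (hS : F.IsPulled f S) :
    ∃ σ ∈ F.cones, S ⊆ σ ∧ ∀ r ∈ F.rayGens, (∀ s ∈ S, f r < f s) → r ∉ σ := by
  rcases S.eq_empty_or_nonempty with rfl | hne
  · exact ⟨⊥, bot_mem, Set.empty_subset _, fun r hr _ h =>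
      ne_zero_of_mem_rayGens hr (by simpa using h)⟩
  · obtain ⟨s, hs, hmin⟩ := exists_minimalFor_of_wellFoundedLT (· ∈ S) f hne
    obtain ⟨σ, hσ, hSσ, hmin'⟩ := hS.2 s hs
    refine ⟨σ, hσ, fun t ht => hSσ ⟨ht, ?_⟩, fun r hr hlt hrσ => ?_⟩
    · rcases le_total (f s) (f t) with h | h
      · exact h
      · exact hmin ht h
    · exact (hlt s hs).not_ge (hmin' r hr hrσ)

/-- The combination lies in a cone `τ` that avoids the earlier ray `v`. Equality would place `t • v
+ y` in the common face of `σ` and `τ`, and a face containing the sum contains `v`. -/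
theorem IsPulled.notMem_of_linearCombination_mem {c : V →₀ ℝ} (hc : 0 ≤ c)
    (hS : F.IsPulled f c.support) {v : V} (hv : v ∈ F.rayGens) (hlt : ∀ s ∈ c.support, f v < f s)
    {σ : PointedCone ℝ V} (hσ : σ ∈ F.cones) {t : ℝ} (ht : 0 < t) {y : V} (hvσ : v ∈ σ)
    (hy : y ∈ σ) : Finsupp.linearCombination ℝ id c ≠ t • v + y := by
  intro h
  obtain ⟨τ, hτ, hcτ, hnot⟩ := hS.exists_cone
  refine hnot v hv hlt ((F.inter_isFaceOf σ hσ τ hτ).mem_of_smul_add_mem hvσ hy ht ?_).2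
  rw [← h]
  exact ⟨h ▸ add_mem (σ.smul_mem ht.le hvσ) hy, PointedCone.linearCombination_mem hc hcτ⟩

/-- Nonnegative combinations of pulled sets are determined by their sum. -/
theorem IsPulled.linearCombination_injective (hf : Set.InjOn f F.rayGens) (c d : V →₀ ℝ)
    (hc : 0 ≤ c) (hd : 0 ≤ d) (hcS : F.IsPulled f c.support) (hdS : F.IsPulled f d.support)
    (h : Finsupp.linearCombination ℝ id c = Finsupp.linearCombination ℝ id d) : c = d := by
  classical
  have hzero : ∀ c : V →₀ ℝ, 0 ≤ c → F.IsPulled f c.support →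
      Finsupp.linearCombination ℝ id c = 0 → c = 0 := by
    intro c hc hcS h
    obtain ⟨σ, hσ, hcσ, -⟩ := hcS.exists_cone
    have := (PointedCone.bot_isFaceOf (F.stronglyConvex σ hσ)).support_subset hc hcσ (by simp [h])
    rw [← Finsupp.support_eq_empty, Finset.eq_empty_iff_forall_notMem]
    intro v hv
    exact ne_zero_of_mem_rayGens (hcS.1 hv) (by simpa using this hv)
  induction hn : c.support.card using Nat.strong_induction_on generalizing c d with
  | _ n ih =>
  rcases eq_or_ne c 0 with rfl | hc0
  · exact (hzero d hd hdS (by simpa using h.symm)).symm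
  rcases eq_or_ne d 0 with rfl | hd0
  · exact hzero c hc hcS (by simpa using h)
  have hmin : ∀ c : V →₀ ℝ, 0 ≤ c → F.IsPulled f c.support → c ≠ 0 → ∃ v ∈ c.support,
      ∃ σ ∈ F.cones, (c.support : Set V) ⊆ σ ∧ (∀ r ∈ F.rayGens, r ∈ σ → f v ≤ f r) ∧
      ∀ s ∈ (c.erase v).support, f v < f s := by
    intro c hc hcS hc0
    obtain ⟨v, hv, hvmin⟩ := c.support.exists_min_image f (Finsupp.support_nonempty_iff.2 hc0)
    obtain ⟨σ, hσ, hcσ, hmin⟩ := hcS.2 v hv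
    refine ⟨v, hv, σ, hσ, fun s hs => hcσ ⟨hs, hvmin s hs⟩, hmin, fun s hs => ?_⟩
    rw [Finsupp.support_erase, Finset.mem_erase] at hs
    exact lt_of_le_of_ne (hvmin s hs.2) fun e => hs.1 (hf (hcS.1 hs.2) (hcS.1 hv) e.symm)
  obtain ⟨v, hv, σ, hσ, hcσ, hvσ, hvlt⟩ := hmin c hc hcS hc0
  obtain ⟨w, hw, τ, hτ, hdτ, hwτ, hwlt⟩ := hmin d hd hdS hd0
  -- The common sum lies in a common face, so both supports lie in both cones, and the earliest
  -- elements `v` and `w` must coincide.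
  have hmem : Finsupp.linearCombination ℝ id c ∈ σ ⊓ τ :=
    ⟨PointedCone.linearCombination_mem hc hcσ, h ▸ PointedCone.linearCombination_mem hd hdτ⟩
  have hcτ := (F.inter_isFaceOf σ hσ τ hτ).support_subset hc hcσ hmem
  have hdσ := (F.inter_isFaceOf τ hτ σ hσ).support_subset hd hdτ (by rwa [inf_comm, ← h])
  obtain rfl : v = w := hf (hcS.1 hv) (hdS.1 hw)
    (le_antisymm (hvσ w (hdS.1 hw) (hdσ hw).2) (hwτ v (hcS.1 hv) (hcτ hv).2))
  have herase : ∀ c : V →₀ ℝ, 0 ≤ c → 0 ≤ c.erase v := by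
    intro c hc u
    by_cases hu : u = v
    · simp [hu]
    · simpa [Finsupp.erase_ne hu] using hc u
  have hsub : ∀ c : V →₀ ℝ, ((c.erase v).support : Set V) ⊆ c.support := fun c u hu => by
    simp_all
  have hsplit : ∀ c : V →₀ ℝ, Finsupp.linearCombination ℝ id c =
      c v • v + Finsupp.linearCombination ℝ id (c.erase v) := by
    intro c
    conv_lhs => rw [← Finsupp.single_add_erase v c, map_add, Finsupp.linearCombination_single]
    rfl
  have key : ∀ c d : V →₀ ℝ, 0 ≤ c → 0 ≤ d → F.IsPulled f c.support → v ∈ c.support →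
      (∀ s ∈ (c.erase v).support, f v < f s) → ∀ τ ∈ F.cones, (d.support : Set V) ⊆ τ →
      v ∈ d.support →
      Finsupp.linearCombination ℝ id c = Finsupp.linearCombination ℝ id d → d v ≤ c v := by
    intro c d hc hd hcS hvc hlt τ hτ hdτ hvd h
    -- Cancelling `c v • v` would express a combination of elements later than `v` with a positive
    -- multiple of `v` left over.
    by_contra! hlt'
    refine (hcS.mono (hsub c)).notMem_of_linearCombination_mem (herase c hc) (hcS.1 hvc) hlt hτ
      (sub_pos.2 hlt') (hdτ hvd)
      (PointedCone.linearCombination_mem (herase d hd) ((hsub d).trans hdτ)) ?_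
    rw [hsplit c, hsplit d] at h
    rw [sub_smul, sub_add_eq_add_sub, ← h, add_sub_cancel_left]
  have hcd : c v = d v := le_antisymm (key d c hd hc hdS hw hwlt σ hσ hcσ hv h.symm)
    (key c d hc hd hcS hv hvlt τ hτ hdτ hw h)
  have herase_eq : c.erase v = d.erase v := by
    refine ih _ ?_ _ _ (herase c hc) (herase d hd) (hcS.mono (hsub c)) (hdS.mono (hsub d)) ?_ rfl
    · rw [← hn, Finsupp.support_erase]
      exact Finset.card_erase_lt_of_mem hv
    · rw [hsplit c, hsplit d, hcd] at h
      exact add_left_cancel h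
  rw [← Finsupp.single_add_erase v c, ← Finsupp.single_add_erase v d, herase_eq, hcd]

/-- The positive and negative parts of a linear relation are two nonnegative combinations with equal
sum, hence equal. -/
theorem IsPulled.linearIndepOn (hf : Set.InjOn f F.rayGens) {S : Set V} (hS : F.IsPulled f S) :
    LinearIndepOn ℝ id S := by
  rw [linearIndepOn_iff]
  intro l hl h
  rw [Finsupp.mem_supported] at hl
  let p : V →₀ ℝ := l.mapRange (fun x => max x 0) (by simp)
  let q : V →₀ ℝ := l.mapRange (fun x => max (-x) 0) (by simp)
  have hpq : l = p - q := by
    ext v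
    rcases le_total (l v) 0 with h | h <;> simp [p, q, h]
  have hpS : (p.support : Set V) ⊆ S :=
    subset_trans (by exact_mod_cast Finsupp.support_mapRange) hl
  have hqS : (q.support : Set V) ⊆ S :=
    subset_trans (by exact_mod_cast Finsupp.support_mapRange) hl
  rw [hpq, map_sub, sub_eq_zero] at h
  rw [hpq, sub_eq_zero]
  exact IsPulled.linearCombination_injective hf p q (fun v => by simp [p]) (fun v => by simp [q])
    (hS.mono hpS) (hS.mono hqS) h

/-- The face property of the cones of the pulling refinement. -/
theorem IsPulled.inf_isFaceOf (hf : Set.InjOn f F.rayGens) {S T : Set V} (hS : F.IsPulled f S)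
    (hT : F.IsPulled f T) :
    (PointedCone.hull ℝ S ⊓ PointedCone.hull ℝ T).IsFaceOf (PointedCone.hull ℝ S) := by
  classical
  refine PointedCone.IsFaceOf.of_mem_of_add_mem_left inf_le_left ?_
  rintro x y hx hy ⟨-, hxy⟩
  refine ⟨hx, ?_⟩
  obtain ⟨a, haS, ha, rfl⟩ := PointedCone.mem_hull_iff_linearCombination.1 hx
  obtain ⟨b, hbS, hb, rfl⟩ := PointedCone.mem_hull_iff_linearCombination.1 hy
  obtain ⟨c, hcT, hc, hxy⟩ := PointedCone.mem_hull_iff_linearCombination.1 hxy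
  rw [← map_add] at hxy
  have hab : ((a + b).support : Set V) ⊆ S := by
    refine subset_trans (by exact_mod_cast Finsupp.support_add) ?_
    rw [Finset.coe_union]
    exact Set.union_subset haS hbS
  have h := IsPulled.linearCombination_injective hf c (a + b) hc (add_nonneg ha hb) (hT.mono hcT)
    (hS.mono hab) hxy
  refine PointedCone.mem_hull_iff_linearCombination.2 ⟨a, fun v hv => hcT ?_, ha, rfl⟩
  have h1 := ha v
  have h2 := hb v
  simp only [h, Finset.mem_coe, Finsupp.mem_support_iff, Finsupp.add_apply, Finsupp.coe_zero,
    Pi.zero_apply] at hv h1 h2 ⊢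
  intro h3
  exact hv (by linarith)

/-- For `q ∈ Q`, take the least cone containing `q` and the later elements of `Q`. A ray `r` of it
earlier than `q` would belong to `P`. A cone containing `P` without `r` then contains this least
cone, hence `r`, hence all of `P`, which is impossible. -/
theorem IsPrimitiveCollection.isPulled {P Q : Finset V} (hP : F.IsPrimitiveCollection P)
    (hQ : Q ⊂ P) (hlt : ∀ p ∈ P, ∀ r ∉ P, f p < f r) : F.IsPulled f Q := by
  classical
  obtain ⟨hPr, hnot, hsub⟩ := hP
  have hQP : (Q : Set V) ⊆ P := by exact_mod_cast hQ.subset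
  refine ⟨hQP.trans hPr, fun q hq => ?_⟩
  obtain ⟨τ₀, hτ₀, hQτ₀⟩ := hsub Q hQ
  obtain ⟨τ, hτ, hQτ, hmin⟩ := exists_least_cone (F := F) (S := {t ∈ (Q : Set V) | f q ≤ f t})
    ⟨τ₀, hτ₀, (Set.sep_subset _ _).trans hQτ₀⟩
  refine ⟨τ, hτ, hQτ, fun r hr hrτ => ?_⟩
  by_contra! hrq
  have hrP : r ∈ P := by
    by_contra hrP
    exact (hlt q (hQP hq) r hrP).not_gt hrq
  obtain ⟨ρ, hρ, hPρ⟩ := hsub (P.erase r) (Finset.erase_ssubset hrP)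
  have hrρ : r ∈ ρ := hmin ρ hρ (fun t ht => hPρ (by
    rw [Finset.mem_coe, Finset.mem_erase]
    exact ⟨fun h => (h ▸ ht.2).not_gt hrq, hQP ht.1⟩)) hrτ
  refine hnot ⟨ρ, hρ, fun p hp => ?_⟩
  by_cases hpr : p = r
  · exact hpr ▸ hrρ
  · exact hPρ (by simpa [hpr] using hp)

end Fan

/-! ### The pulling refinement as a simplicial fan with the same rays. -/

namespace Fan

variable {V : Type*} [NormedAddCommGroup V] [NormedSpace ℝ V] {L : Submodule ℤ V}
  [DiscreteTopology L] {F : Fan L} {f : V → ℕ}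

/-- Every point of the support lies in a cone of the pulling refinement. -/
theorem exists_isPulled_mem_hull {σ : PointedCone ℝ V} (hσ : σ ∈ F.cones) {x : V}
    (hx : x ∈ σ) : ∃ S, F.IsPulled f S ∧ S ⊆ σ ∧ x ∈ PointedCone.hull ℝ S := by
  -- The induction is on the number of rays of the cone; the face reached below loses the ray `v`.
  induction hn : (F.rayGens ∩ (σ : Set V)).ncard using Nat.strong_induction_on generalizing σ x with
  | _ n ih =>
  have hfin : (F.rayGens ∩ (σ : Set V)).Finite := F.rayGens_finite.subset Set.inter_subset_left
  rcases (F.rayGens ∩ (σ : Set V)).eq_empty_or_nonempty with he | hne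
  · refine ⟨∅, ⟨Set.empty_subset _, by simp⟩, Set.empty_subset _, ?_⟩
    rwa [← he, hull_rayGens_inter hσ]
  obtain ⟨v, hv, hvmin⟩ := hfin.exists_minimalFor f _ hne
  replace hvmin : ∀ r ∈ F.rayGens, r ∈ σ → f v ≤ f r := fun r hr hrσ => by
    rcases le_total (f v) (f r) with h | h
    · exact h
    · exact hvmin ⟨hr, hrσ⟩ h
  have hhull : PointedCone.hull ℝ (hfin.toFinset : Set V) = σ := by
    rw [hfin.coe_toFinset, hull_rayGens_inter hσ]
  obtain ⟨t, ht, y, hy, rfl, hmax⟩ := PointedCone.exists_eq_smul_add_maximal hfin.toFinset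
    (fun h => ne_zero_of_mem_rayGens (hfin.mem_toFinset.1 h).1 rfl)
    (by rw [hhull]; exact F.stronglyConvex σ hσ) (hfin.mem_toFinset.2 hv) (hhull.symm ▸ hx)
  rw [hhull] at hy hmax
  have hface := PointedCone.faceAt_isFaceOf hy
  -- Membership of `v` in the smallest face at `y` would allow a further multiple of `v` to be
  -- subtracted.
  have hvy : v ∉ σ.faceAt y hy := fun ⟨_, ε, hε, h⟩ => hmax ε hε h
  obtain ⟨S, hS, hSτ, hyS⟩ := ih _ (by
    rw [← hn]
    refine Set.ncard_lt_ncard ⟨Set.inter_subset_inter_right _ hface.le, fun h => hvy (h hv).2⟩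
      hfin) (F.face_mem σ hσ _ hface) (PointedCone.self_mem_faceAt hy) rfl
  have hSσ : insert v S ⊆ (σ : Set V) := Set.insert_subset hv.2 (hSτ.trans hface.le)
  refine ⟨insert v S, ⟨Set.insert_subset hv.1 hS.1, ?_⟩, hSσ, ?_⟩
  · intro s hs
    by_cases hsv : f s ≤ f v
    · exact ⟨σ, hσ, (Set.sep_subset _ _).trans hSσ, fun r hr hrσ => hsv.trans (hvmin r hr hrσ)⟩
    · have hsS : s ∈ S := hs.resolve_left fun h => hsv (h ▸ le_rfl)
      obtain ⟨τ, hτ, hSτ, hmin⟩ := hS.2 s hsS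
      refine ⟨τ, hτ, ?_, hmin⟩
      rintro u ⟨rfl | hu, hsu⟩
      · exact absurd hsu hsv
      · exact hSτ ⟨hu, hsu⟩
  · exact add_mem (PointedCone.smul_mem _ ht (PointedCone.subset_hull (Set.mem_insert _ _)))
      (Submodule.span_mono (Set.subset_insert _ _) hyS)

variable (F) in
/-- The pulling refinement of a fan for an order of its ray generators. -/
def pullingRefinement (hf : Set.InjOn f F.rayGens) : Fan L where
  cones := {σ | ∃ S, F.IsPulled f S ∧ PointedCone.hull ℝ S = σ}
  finite := by
    refine (F.rayGens_finite.finite_subsets.image fun S => PointedCone.hull ℝ S).subset ?_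
    rintro _ ⟨S, hS, rfl⟩
    exact ⟨S, hS.1, rfl⟩
  nonempty := ⟨_, ∅, ⟨Set.empty_subset _, by simp⟩, rfl⟩
  rational := by
    rintro _ ⟨S, hS, rfl⟩
    have hfin := F.rayGens_finite.subset hS.1
    refine ⟨hfin.toFinset, ?_, by rw [hfin.coe_toFinset]⟩
    rw [hfin.coe_toFinset]
    exact fun s hs => (hS.1 hs).1.1
  stronglyConvex := by
    rintro _ ⟨S, hS, rfl⟩
    obtain ⟨σ, hσ, hSσ, -⟩ := hS.exists_cone
    exact PointedCone.lineal_eq_bot_of_le (F.stronglyConvex σ hσ) (Submodule.span_le.2 hSσ)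
  face_mem := by
    rintro _ ⟨S, hS, rfl⟩ τ hτ
    -- A face is spanned by the generators it contains, and subsets of pulled sets are pulled.
    refine ⟨S ∩ τ, hS.mono Set.inter_subset_left, le_antisymm
      (Submodule.span_le.2 Set.inter_subset_right) fun x hx => ?_⟩
    obtain ⟨c, hcS, hc, rfl⟩ := PointedCone.mem_hull_iff_linearCombination.1 (hτ.le hx)
    exact PointedCone.mem_hull_iff_linearCombination.2 ⟨c, Set.subset_inter hcS
      (hτ.support_subset hc (hcS.trans PointedCone.subset_hull) hx), hc, rfl⟩
  inter_isFaceOf := by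
    rintro _ ⟨S, hS, rfl⟩ _ ⟨T, hT, rfl⟩
    exact hS.inf_isFaceOf hf hT

theorem pullingRefinement_isSimplicial (hf : Set.InjOn f F.rayGens) :
    (F.pullingRefinement hf).IsSimplicial := by
  rintro _ ⟨S, hS, rfl⟩
  exact ⟨S, F.rayGens_finite.subset hS.1, hS.linearIndepOn hf, rfl⟩

theorem pullingRefinement_refines (hf : Set.InjOn f F.rayGens) :
    (F.pullingRefinement hf).Refines F := by
  have hle : ∀ σ' ∈ (F.pullingRefinement hf).cones, ∃ σ ∈ F.cones, σ' ≤ σ := by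
    rintro _ ⟨S, hS, rfl⟩
    obtain ⟨σ, hσ, hSσ, -⟩ := hS.exists_cone
    exact ⟨σ, hσ, Submodule.span_le.2 hSσ⟩
  refine ⟨?_, hle⟩
  ext x
  simp only [support, Set.mem_iUnion, SetLike.mem_coe, exists_prop]
  constructor
  · rintro ⟨σ', hσ', hx⟩
    obtain ⟨σ, hσ, h⟩ := hle σ' hσ'
    exact ⟨σ, hσ, h hx⟩
  · rintro ⟨σ, hσ, hx⟩
    obtain ⟨S, hS, -, hxS⟩ := exists_isPulled_mem_hull (f := f) hσ hx
    exact ⟨_, ⟨S, hS, rfl⟩, hxS⟩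

theorem pullingRefinement_rayGens (hf : Set.InjOn f F.rayGens) :
    (F.pullingRefinement hf).rayGens = F.rayGens := by
  ext u
  constructor
  · rintro ⟨hu, S, hS, hSu⟩
    refine ⟨hu, ?_⟩
    obtain ⟨s, hs⟩ : S.Nonempty := by
      rw [Set.nonempty_iff_ne_empty]
      rintro rfl
      have : u ∈ PointedCone.hull ℝ {u} := PointedCone.subset_hull rfl
      rw [← hSu] at this
      exact hu.2.1 (by simpa using this)
    have hsu : s ∈ PointedCone.hull ℝ {u} := hSu ▸ PointedCone.subset_hull hs
    have := hu.eq_of_mem_hull (hS.1 hs).1 hsu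
    exact this ▸ (hS.1 hs).2
  · intro hu
    refine ⟨hu.1, {u}, ⟨Set.singleton_subset_iff.2 hu, ?_⟩, rfl⟩
    rintro _ rfl
    refine ⟨_, hu.2, fun t ht => PointedCone.subset_hull ht.1, fun r hr hru => ?_⟩
    rw [hu.1.eq_of_mem_hull hr.1 hru]

/-- An order of the ray generators in which a given finite set comes first. -/
theorem exists_injOn_lt (P : Finset V) :
    ∃ f : V → ℕ, Set.InjOn f F.rayGens ∧ ∀ p ∈ P, ∀ r ∉ P, f p < f r := by
  classical
  obtain ⟨g, hg⟩ := Set.countable_iff_exists_injOn.1 F.rayGens_finite.countable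
  have hle : ∀ p ∈ P, g p < P.sup g + 1 := fun p hp => Nat.lt_succ_of_le (Finset.le_sup hp)
  refine ⟨fun r => if r ∈ P then g r else g r + (P.sup g + 1), fun a ha b hb h => ?_,
    fun p hp r hr => ?_⟩
  · refine hg ha hb ?_
    by_cases haP : a ∈ P <;> by_cases hbP : b ∈ P <;> simp only [haP, hbP, if_true, if_false] at h
    · exact h
    · have := hle a haP
      omega
    · have := hle b hbP
      omega
    · omega
  · have := hle p hp
    simp only [hp, hr, if_true, if_false]
    omega

theorem IsPrimitiveCollection.exists_isSupportedOn {P : Finset V}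
    (hP : F.IsPrimitiveCollection P) : ∃ F' : Fan L, F.IsSupportedOn P F' := by
  obtain ⟨f, hf, hlt⟩ := F.exists_injOn_lt P
  refine ⟨F.pullingRefinement hf, pullingRefinement_isSimplicial hf, pullingRefinement_refines hf,
    pullingRefinement_rayGens hf, hP, ?_, ?_, fun Q hQ => ?_⟩
  · rw [pullingRefinement_rayGens hf]
    exact hP.1
  · rintro ⟨σ', hσ', hPσ'⟩
    obtain ⟨σ, hσ, hle⟩ := (pullingRefinement_refines hf).2 σ' hσ'
    exact hP.2.1 ⟨σ, hσ, hPσ'.trans hle⟩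
  · exact ⟨_, ⟨Q, hP.isPulled hQ hlt, rfl⟩, PointedCone.subset_hull⟩

end Fan

/-! ### Transfer of primitive inequalities from a refinement. -/

namespace Fan

variable {V : Type*} [AddCommGroup V] [Module ℝ V] {L : Submodule ℤ V} {F F' : Fan L}

theorem mem_support {x : V} : x ∈ F.support ↔ ∃ σ ∈ F.cones, x ∈ σ := by
  simp [support]

theorem add_mem_support (hF : Convex ℝ F.support) {x y : V} (hx : x ∈ F.support)
    (hy : y ∈ F.support) : x + y ∈ F.support := by
  obtain ⟨σ, hσ, h⟩ := mem_support.1 (hF hx hy (a := 1 / 2) (b := 1 / 2) (by norm_num)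
    (by norm_num) (by norm_num))
  refine mem_support.2 ⟨σ, hσ, ?_⟩
  have := σ.smul_mem zero_le_two h
  rwa [smul_add, smul_smul, smul_smul, mul_one_div_cancel two_ne_zero, one_smul, one_smul] at this

theorem map_sum_of_mem_PL {φ : V → ℝ} (hφ : φ ∈ F.PL) {σ : PointedCone ℝ V} (hσ : σ ∈ F.cones)
    {P : Finset V} (hP : (P : Set V) ⊆ σ) : φ (∑ u ∈ P, u) = ∑ u ∈ P, φ u := by
  obtain ⟨m, hm⟩ := hφ.1 σ hσ
  rw [hm _ (sum_mem fun u hu => hP hu), map_sum]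
  exact Finset.sum_congr rfl fun u hu => (hm u (hP hu)).symm

theorem satisfiesPrimitiveInequality_of_mem_CPL (hF : Convex ℝ F.support) {φ : V → ℝ}
    (hφ : φ ∈ F.CPL) {P : Finset V} (hP : (P : Set V) ⊆ F.support) :
    SatisfiesPrimitiveInequality φ P := by
  classical
  have key : (∑ u ∈ P, u) ∈ F.support ∧ φ (∑ u ∈ P, u) ≤ ∑ u ∈ P, φ u := by
    induction P using Finset.induction_on with
    | empty =>
      exact ⟨mem_support.2 ⟨⊥, bot_mem, by simp⟩,
        (map_sum_of_mem_PL hφ.1 bot_mem (P := ∅) (by simp)).le⟩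
    | insert a s ha ih =>
      rw [Finset.coe_insert, Set.insert_subset_iff] at hP
      obtain ⟨h1, h2⟩ := ih hP.2
      rw [Finset.sum_insert ha, Finset.sum_insert ha]
      exact ⟨add_mem_support hF hP.1 h1, (hφ.2 a hP.1 _ h1).trans (by gcongr)⟩
  exact key.2

theorem rayGens_subset_support : F.rayGens ⊆ F.support := fun _ hu =>
  mem_support.2 ⟨_, hu.2, PointedCone.subset_hull rfl⟩

theorem Refines.PL_le (h : F'.Refines F) : F.PL ≤ F'.PL := by
  rintro φ ⟨h1, h2⟩
  refine ⟨fun σ' hσ' => ?_, fun u hu => h2 u (h.1 ▸ hu)⟩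
  obtain ⟨σ, hσ, hle⟩ := h.2 σ' hσ'
  obtain ⟨m, hm⟩ := h1 σ hσ
  exact ⟨m, fun u hu => hm u (hle hu)⟩

/-- Primitive inequalities define `CPL` of a fan if they do so for a refinement with the same
rays. -/
theorem CPLDefinedByPrimitiveInequalities.of_refines (h : F'.Refines F)
    (hrays : F'.rayGens = F.rayGens) (hF : Convex ℝ F.support)
    (hF' : F'.CPLDefinedByPrimitiveInequalities) : F.CPLDefinedByPrimitiveInequalities := by
  refine Set.Subset.antisymm (fun φ hφ => ⟨hφ.1, fun P hP =>
    satisfiesPrimitiveInequality_of_mem_CPL hF hφ (hP.1.trans rayGens_subset_support)⟩) ?_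
  rintro φ ⟨hφ, hineq⟩
  have hφ' : φ ∈ F'.CPL := by
    rw [hF']
    refine ⟨h.PL_le hφ, fun P hP => ?_⟩
    -- Inside a cone of `F` the inequality is an equality by linearity; otherwise `P` is already
    -- primitive for `F`.
    by_cases hPσ : ∃ σ ∈ F.cones, (P : Set V) ⊆ σ
    · obtain ⟨σ, hσ, hPσ⟩ := hPσ
      exact (map_sum_of_mem_PL hφ hσ hPσ).le
    · refine hineq P ⟨hrays ▸ hP.1, hPσ, fun Q hQ => ?_⟩
      obtain ⟨σ', hσ', hQσ'⟩ := hP.2.2 Q hQ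
      obtain ⟨σ, hσ, hle⟩ := h.2 σ' hσ'
      exact ⟨σ, hσ, hQσ'.trans hle⟩
  exact ⟨hφ, fun u hu v hv => hφ'.2 u (h.1.symm ▸ hu) v (h.1.symm ▸ hv)⟩

end Fan

theorem CasagrandeConjecture.cplDefinedByPrimitiveInequalities {V : Type*} [NormedAddCommGroup V]
    [NormedSpace ℝ V] {L : Submodule ℤ V} [DiscreteTopology L] (hL : CasagrandeConjecture L)
    {F : Fan L} (hF : F.HasConvexFullDimSupport) : F.CPLDefinedByPrimitiveInequalities := by
  -- Any order of the rays serves here, so no set is required to come first.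
  obtain ⟨f, hf, -⟩ := F.exists_injOn_lt ∅
  have href := Fan.pullingRefinement_refines hf
  refine Fan.CPLDefinedByPrimitiveInequalities.of_refines href (Fan.pullingRefinement_rayGens hf)
    hF.1 (hL _ (Fan.pullingRefinement_isSimplicial hf) ?_)
  rw [Fan.HasConvexFullDimSupport, href.1]
  exact hF

end Toric

theorem mainTheorem9 {V : Type*} [NormedAddCommGroup V] [NormedSpace ℝ V] [FiniteDimensional ℝ V]
    (L : Submodule ℤ V) [DiscreteTopology L] [IsZLattice ℝ L]
    (F : Toric.Fan L) (hsupp : F.HasConvexFullDimSupport) (hns : ¬ F.IsSimplicial) :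
    (Toric.CasagrandeConjecture L → F.CPLDefinedByPrimitiveInequalities) ∧
      ∀ P : Finset V, F.IsPrimitiveCollection P → ∃ F' : Toric.Fan L, F.IsSupportedOn P F' :=
  ⟨fun hL => hL.cplDefinedByPrimitiveInequalities hsupp, fun _ hP => hP.exists_isSupportedOn⟩
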